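/- Let $n\ge 1$, $\epsilon\in(0,1)$, $\alpha\ge 0$, $c_1>0$ and $c_2\in\mathbb R\setminus\{0\}$. Put $g_{\rm H}(r):=\sqrt{(1-\epsilon^2)+r^{-2}}$ for $r>0$, and let $\chi_{\rm H}$ be a smooth real-valued function of $r=|\xi|$ with $\chi_{\rm H}(r)=1$ for $r\ge 4(1-\epsilon^2)^{-2}$ and $\chi_{\rm H}(r)=0$ for $0\le r\le 2(1-\epsilon^2)^{-2}$. For $t>0$ and $x\in\mathbb R^n$ let $$\mathcal M(t,x):=\mathcal F^{-1}_{\xi\to x}\left(\mathrm e^{-c_1|\xi|^2t}\,|\xi|^{\alpha}\,\frac{\sin\left(c_2|\xi|^2g_{\rm H}(|\xi|)\,t\right)}{g_{\rm H}(|\xi|)}\,\chi_{\rm H}(|\xi|)\right)(t,x),$$ where $\mathcal F^{-1}f(x)=(2\pi)^{-n}\int_{\mathbb R^n}\mathrm e^{ix\cdot\xi}f(\xi)\,\mathrm d\xi$. Then there is a constant $C>0$, depending only on $n,\epsilon,\alpha,c_1,c_2$ and $\chi_{\rm H}$, such that for every $t>0$ the function in parentheses is integrable in $\xi$, $\mathcal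 M(t,\cdot)\in L^1(\mathbb R^n)$, and $$\|\mathcal M(t,\cdot)\|_{L^1(\mathbb R^n)}\le C\,t^{-\alpha/2}.$$ -/

import Mathlib

open MeasureTheory

open scoped ContDiff

noncomputable section

namespace ViscousBoussinesq

/-- The inverse Fourier transform on `ℝⁿ` in angular frequency,
`(2π)⁻ⁿ ∫ e^{i x·ξ} f(ξ) dξ`, the convention in which `-Δ` has the symbol `|ξ|²`. -/
def invFourier {n : ℕ} (f : EuclideanSpace ℝ (Fin n) → ℂ) (x : EuclideanSpace ℝ (Fin n)) : ℂ :=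
  (((2 * Real.pi) ^ n : ℝ) : ℂ)⁻¹ *
    ∫ ξ : EuclideanSpace ℝ (Fin n), Complex.exp (Complex.I * ((inner ℝ x ξ : ℝ) : ℂ)) * f ξ

/-- A smooth radial high-frequency cut-off, given by its radial profile `χ : r ↦ χ(r)`, `r = |ξ|`.
Only the values on `[0, ∞)` matter. -/
structure IsHighFreqCutoff (ε : ℝ) (χ : ℝ → ℝ) : Prop where
  smooth : ContDiff ℝ ∞ χ
  eq_one : ∀ r : ℝ, 4 * ((1 - ε ^ 2) ^ 2)⁻¹ ≤ r → χ r = 1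
  eq_zero : ∀ r : ℝ, 0 ≤ r → r ≤ 2 * ((1 - ε ^ 2) ^ 2)⁻¹ → χ r = 0

/-- `g_H(r) = √((1 - ε²) + r⁻²)`; the value at `r = 0` is irrelevant, as the cut-off vanishes
there. -/
def gHigh (ε r : ℝ) : ℝ :=
  Real.sqrt ((1 - ε ^ 2) + (r ^ 2)⁻¹)

/-- The symbol `e^{-c₁|ξ|²t} |ξ|^α sin(c₂|ξ|² g_H(|ξ|) t) / g_H(|ξ|) χ_H(|ξ|)`. -/
def symbolHigh {n : ℕ} (ε α c₁ c₂ : ℝ) (χ : ℝ → ℝ) (t : ℝ) (ξ : EuclideanSpace ℝ (Fin n)) : ℝ :=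
  Real.exp (-c₁ * ‖ξ‖ ^ 2 * t) * ‖ξ‖ ^ α *
    (Real.sin (c₂ * ‖ξ‖ ^ 2 * gHigh ε ‖ξ‖ * t) / gHigh ε ‖ξ‖) * χ ‖ξ‖

/-- The oscillatory kernel `M(t, x)`, the inverse Fourier transform of the symbol. -/
def kernelHigh {n : ℕ} (ε α c₁ c₂ : ℝ) (χ : ℝ → ℝ) (t : ℝ) (x : EuclideanSpace ℝ (Fin n)) : ℂ :=
  invFourier (fun ξ : EuclideanSpace ℝ (Fin n) => ((symbolHigh ε α c₁ c₂ χ t ξ : ℝ) : ℂ)) x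

end ViscousBoussinesq

end

namespace ViscousBoussinesq

open Set Filter Topology

/-! Substituting `η = √t ξ` turns the symbol into `t^(-α/2) F_t(|η|²)` with `F_t = profile … t`, and
dilating the frequency does not change the `L¹` norm of an inverse Fourier transform. It remains to
bound that norm for `F_t(|η|²)` uniformly in `t`.

The cut-off confines `s = |η|²` to `s > a t`, where `b s + t` is comparable to `s`, so every factor
obeys symbol estimates uniform in `t`. Since `|sin φ| ≤ |φ| ≲ s`, the product has weight `s e^{-cs}`
(`isSymbol_profile`), so the `k`-th derivatives in `η` are `O(|η|^(2-k) e^{-c|η|²})`. The gained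
`|η|²` makes them integrable at the origin for all `k ≤ n + 1` (`integrable_norm_sq_mul_exp`), and
`n + 1` integrable derivatives give an integrable Fourier transform
(`exists_integral_norm_invFourier_le`). -/

/-- Symbol estimates `|∂ₛᵏ fₜ(s)| ≤ C w(s) s⁻ᵏ` for `k ≤ N` and `s > a t`, uniform in the
parameter `t > 0`. -/
def IsSymbol (a : ℝ) (N : ℕ) (w : ℝ → ℝ) (f : ℝ → ℝ → ℝ) : Prop :=
  (∀ s, 0 < s → 0 ≤ w s) ∧ (∀ t, 0 < t → ContDiffOn ℝ ∞ (f t) (Ioi (a * t))) ∧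
    ∃ C, 0 ≤ C ∧ ∀ t, 0 < t → ∀ s, a * t < s → ∀ k ≤ N,
      |iteratedDeriv k (f t) s| ≤ C * (w s / s ^ k)

/-! ### Calculus of symbol estimates uniform in `t`. -/

namespace IsSymbol

variable {a : ℝ} {N : ℕ} {v w : ℝ → ℝ} {f g : ℝ → ℝ → ℝ}

theorem contDiffAt (hf : IsSymbol a N w f) {t s : ℝ} (ht : 0 < t) (hs : a * t < s) :
    ContDiffAt ℝ ∞ (f t) s :=
  (hf.2.1 t ht).contDiffAt (Ioi_mem_nhds hs)

theorem mono_weight (ha : 0 < a) (hf : IsSymbol a N v f) (hw : ∀ s, 0 < s → 0 ≤ w s)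
    {K : ℝ} (hK : 0 ≤ K) (h : ∀ s, 0 < s → v s ≤ K * w s) : IsSymbol a N w f := by
  obtain ⟨-, h1, C, hC, h2⟩ := hf
  refine ⟨hw, h1, C * K, by positivity, fun t ht s hs k hk => (h2 t ht s hs k hk).trans ?_⟩
  have hs0 : 0 < s := (by positivity : 0 < a * t).trans hs
  calc C * (v s / s ^ k) ≤ C * (K * w s / s ^ k) := by gcongr; exact h s hs0
    _ = _ := by ring

theorem mul (ha : 0 < a) (hf : IsSymbol a N v f) (hg : IsSymbol a N w g) :
    IsSymbol a N (fun s => v s * w s) (fun t s => f t s * g t s) := by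
  obtain ⟨hv, hf1, A, hA, hf2⟩ := id hf
  obtain ⟨hw, hg1, B, hB, hg2⟩ := id hg
  refine ⟨fun s hs => mul_nonneg (hv s hs) (hw s hs), fun t ht => (hf1 t ht).mul (hg1 t ht),
    2 ^ N * (A * B), by positivity, fun t ht s hs k hk => ?_⟩
  have hs0 : 0 < s := (by positivity : 0 < a * t).trans hs
  have hv0 := hv s hs0
  have hw0 := hw s hs0
  rw [iteratedDeriv_fun_mul ((hf.contDiffAt ht hs).of_le (by exact_mod_cast le_top))
    ((hg.contDiffAt ht hs).of_le (by exact_mod_cast le_top))]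
  calc _ ≤ ∑ i ∈ Finset.range (k + 1), (k.choose i : ℝ) * (A * B * (v s * w s / s ^ k)) := by
        refine (Finset.abs_sum_le_sum_abs _ _).trans (Finset.sum_le_sum fun i hi => ?_)
        have hik : i ≤ k := Nat.lt_succ_iff.mp (Finset.mem_range.mp hi)
        rw [mul_assoc, abs_mul, abs_mul, Nat.abs_cast]
        refine mul_le_mul_of_nonneg_left ?_ (Nat.cast_nonneg _)
        calc _ ≤ (A * (v s / s ^ i)) * (B * (w s / s ^ (k - i))) :=
              mul_le_mul (hf2 t ht s hs i (hik.trans hk)) (hg2 t ht s hs _ ((Nat.sub_le _ _).trans hk))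
                (abs_nonneg _) (by positivity)
          _ = A * B * (v s * w s / (s ^ i * s ^ (k - i))) := by field_simp
          _ = _ := by rw [← pow_add, Nat.add_sub_cancel' hik]
    _ = 2 ^ k * (A * B * (v s * w s / s ^ k)) := by
        rw [← Finset.sum_mul]
        congr 1
        exact_mod_cast Nat.sum_range_choose k
    _ ≤ 2 ^ N * (A * B * (v s * w s / s ^ k)) := by
        gcongr
        norm_num
    _ = _ := by ring

/-- Symbol estimates for `f` follow from the bound on `f` and symbol estimates for `∂ₛ f`. -/
theorem of_deriv (ha : 0 < a) (hw : ∀ s, 0 < s → 0 ≤ w s)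
    (h1 : ∀ t, 0 < t → ContDiffOn ℝ ∞ (f t) (Ioi (a * t)))
    {C : ℝ} (hC : ∀ t, 0 < t → ∀ s, a * t < s → |f t s| ≤ C * w s)
    (hfg : ∀ t, 0 < t → ∀ s, a * t < s → HasDerivAt (f t) (g t s) s)
    (h : IsSymbol a N (fun s => w s / s) g) :
    IsSymbol a (N + 1) w f := by
  obtain ⟨-, -, B, hB, h2⟩ := h
  refine ⟨hw, h1, max B C, le_max_of_le_left hB, fun t ht s hs k hk => ?_⟩
  have hs0 : 0 < s := (by positivity : 0 < a * t).trans hs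
  have hw0 := hw s hs0
  rcases k with _ | k
  · simp only [iteratedDeriv_zero, pow_zero, div_one]
    refine (hC t ht s hs).trans ?_
    gcongr
    exact le_max_right _ _
  · have e : deriv (f t) =ᶠ[𝓝 s] g t := by
      filter_upwards [Ioi_mem_nhds hs] with u hu using (hfg t ht u hu).deriv
    rw [iteratedDeriv_succ', e.iteratedDeriv_eq]
    refine (h2 t ht s hs k (by omega)).trans ?_
    rw [div_div, ← pow_succ']
    gcongr
    exact le_max_left _ _

theorem of_bound (hw : ∀ s, 0 < s → 0 ≤ w s)
    (h1 : ∀ t, 0 < t → ContDiffOn ℝ ∞ (f t) (Ioi (a * t)))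
    {C : ℝ} (h0 : 0 ≤ C) (hC : ∀ t, 0 < t → ∀ s, a * t < s → |f t s| ≤ C * w s) :
    IsSymbol a 0 w f := by
  refine ⟨hw, h1, C, h0, fun t ht s hs k hk => ?_⟩
  obtain rfl := Nat.le_zero.mp hk
  simpa using hC t ht s hs

theorem bound_zero (hf : IsSymbol a N w f) :
    ∃ C, 0 ≤ C ∧ ∀ t, 0 < t → ∀ s, a * t < s → |f t s| ≤ C * w s := by
  obtain ⟨-, -, C, hC, h2⟩ := hf
  exact ⟨C, hC, fun t ht s hs => by simpa using h2 t ht s hs 0 (Nat.zero_le _)⟩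

theorem deriv_right (hf : IsSymbol a (N + 1) w f) :
    IsSymbol a N (fun s => w s / s) (fun t => deriv (f t)) := by
  obtain ⟨hw, h1, C, hC, h2⟩ := hf
  refine ⟨fun s hs => div_nonneg (hw s hs) hs.le,
    fun t ht => (h1 t ht).deriv_of_isOpen isOpen_Ioi (by simp), C, hC,
    fun t ht s hs k hk => ?_⟩
  have := h2 t ht s hs (k + 1) (by omega)
  rwa [iteratedDeriv_succ', pow_succ', ← div_div] at this

theorem const_mul (hf : IsSymbol a N w f) (c : ℝ) : IsSymbol a N w (fun t s => c * f t s) := by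
  obtain ⟨hw, h1, C, hC, h2⟩ := id hf
  refine ⟨hw, fun t ht => contDiffOn_const.mul (h1 t ht), |c| * C, by positivity,
    fun t ht s hs k hk => ?_⟩
  rw [iteratedDeriv_const_mul_field, abs_mul, mul_assoc]
  exact mul_le_mul_of_nonneg_left (h2 t ht s hs k hk) (abs_nonneg c)

end IsSymbol

/-! ### Symbol estimates for powers, exponential, sine and cut-off. -/

variable {a : ℝ}

/-- For `s > a t` one has `b s ≤ b s + δ t ≤ (b + δ/a) s`; a derivative lowers `β` by one, so the
induction runs over all `β`. -/
theorem isSymbol_rpow (ha : 0 < a) {b δ : ℝ} (hb : 0 < b) (hδ : 0 ≤ δ) (N : ℕ) (β : ℝ) :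
    IsSymbol a N (fun s => s ^ β) (fun t s => (b * s + δ * t) ^ β) := by
  have hpos : ∀ t, 0 < t → ∀ s, a * t < s → 0 < s ∧ 0 < b * s + δ * t := fun t ht s hs => by
    have hs0 : 0 < s := (by positivity : 0 < a * t).trans hs
    exact ⟨hs0, by positivity⟩
  have hsm (β : ℝ) : ∀ t, 0 < t →
      ContDiffOn ℝ ∞ (fun s => (b * s + δ * t) ^ β) (Ioi (a * t)) := fun t ht s hs =>
    ((by fun_prop : ContDiffAt ℝ ∞ (fun s => b * s + δ * t) s).rpow_const_of_ne
      (hpos t ht s hs).2.ne').contDiffWithinAt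
  have hbd (β : ℝ) : ∃ C, 0 ≤ C ∧ ∀ t, 0 < t → ∀ s, a * t < s →
      |(b * s + δ * t) ^ β| ≤ C * s ^ β := by
    refine ⟨max (b ^ β) ((b + δ / a) ^ β), by positivity, fun t ht s hs => ?_⟩
    obtain ⟨hs0, h⟩ := hpos t ht s hs
    have h1 : t ≤ s / a := by rw [le_div_iff₀ ha]; linarith
    have h2 : b * s + δ * t ≤ (b + δ / a) * s := by
      calc _ ≤ b * s + δ * (s / a) := by gcongr
        _ = _ := by ring
    have h3 : b * s ≤ b * s + δ * t := by have := mul_nonneg hδ ht.le; linarith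
    rw [abs_of_nonneg (by positivity)]
    rcases le_total 0 β with hβ | hβ
    · calc _ ≤ ((b + δ / a) * s) ^ β := Real.rpow_le_rpow h.le h2 hβ
        _ = (b + δ / a) ^ β * s ^ β := Real.mul_rpow (by positivity) hs0.le
        _ ≤ _ := by gcongr; exact le_max_right _ _
    · calc _ ≤ (b * s) ^ β := Real.rpow_le_rpow_of_nonpos (by positivity) h3 hβ
        _ = b ^ β * s ^ β := Real.mul_rpow hb.le hs0.le
        _ ≤ _ := by gcongr; exact le_max_left _ _
  have hw (β : ℝ) : ∀ s : ℝ, 0 < s → 0 ≤ s ^ β := fun s hs => by positivity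
  induction N generalizing β with
  | zero =>
    obtain ⟨C, hC0, hC⟩ := hbd β
    exact .of_bound (hw β) (hsm β) hC0 hC
  | succ N ih =>
    obtain ⟨C, hC0, hC⟩ := hbd β
    refine .of_deriv (g := fun t s => (b * β) * (b * s + δ * t) ^ (β - 1)) ha (hw β) (hsm β) hC
      (fun t ht s hs => ?_) (((ih (β - 1)).const_mul _).mono_weight ha
        (fun s hs => div_nonneg (hw β s hs) hs.le) zero_le_one fun s hs => ?_)
    · have := (((hasDerivAt_id s).const_mul b).add_const (δ * t)).rpow_const (p := β)
        (Or.inl (hpos t ht s hs).2.ne')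
      simpa using this
    · rw [one_mul, Real.rpow_sub_one hs.ne']

theorem isSymbol_rpow_self (ha : 0 < a) (N : ℕ) (β : ℝ) :
    IsSymbol a N (fun s => s ^ β) (fun _ s => s ^ β) := by
  simpa using isSymbol_rpow ha one_pos le_rfl N β

theorem pow_mul_exp_neg_le {c s : ℝ} (hc : 0 < c) (hs : 0 ≤ s) (j : ℕ) :
    s ^ j * Real.exp (-(c * s)) ≤ j.factorial * ((c / 2) ^ j)⁻¹ * Real.exp (-(c / 2 * s)) := by
  have h := Real.pow_div_factorial_le_exp (c / 2 * s) (by positivity) j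
  rw [div_le_iff₀ (by positivity), mul_pow] at h
  have e : Real.exp (-(c * s)) = Real.exp (-(c / 2 * s)) * Real.exp (-(c / 2 * s)) := by
    rw [← Real.exp_add]; ring_nf
  have e2 : Real.exp (c / 2 * s) * Real.exp (-(c / 2 * s)) = 1 := by
    rw [← Real.exp_add]; simp
  calc _ = ((c / 2) ^ j)⁻¹ * ((c / 2) ^ j * s ^ j) * (Real.exp (-(c / 2 * s)) *
        Real.exp (-(c / 2 * s))) := by rw [e]; field_simp
    _ ≤ ((c / 2) ^ j)⁻¹ * (Real.exp (c / 2 * s) * j.factorial) * (Real.exp (-(c / 2 * s)) *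
        Real.exp (-(c / 2 * s))) := by gcongr
    _ = ((c / 2) ^ j)⁻¹ * j.factorial * (Real.exp (c / 2 * s) * Real.exp (-(c / 2 * s))) *
        Real.exp (-(c / 2 * s)) := by ring
    _ = _ := by rw [e2]; ring

/-- Differentiation gains no `s⁻¹` here; half of the exponential decay pays for it. With `j` free in
the induction, that half is lost only once. -/
theorem isSymbol_exp (ha : 0 < a) {c : ℝ} (hc : 0 < c) (N j : ℕ) :
    IsSymbol a N (fun s => Real.exp (-(c / 2 * s)) / s ^ j) (fun _ s => Real.exp (-(c * s))) := by
  have hsm : ∀ t : ℝ, 0 < t → ContDiffOn ℝ ∞ (fun s => Real.exp (-(c * s))) (Ioi (a * t)) :=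
    fun t _ => by fun_prop
  have hw (j : ℕ) : ∀ s : ℝ, 0 < s → 0 ≤ Real.exp (-(c / 2 * s)) / s ^ j :=
    fun s hs => by positivity
  have hbd (j : ℕ) : ∀ t : ℝ, 0 < t → ∀ s, a * t < s → |Real.exp (-(c * s))| ≤
      (j.factorial * ((c / 2) ^ j)⁻¹) * (Real.exp (-(c / 2 * s)) / s ^ j) := fun t ht s hs => by
    have hs0 : 0 < s := (by positivity : 0 < a * t).trans hs
    rw [abs_of_pos (Real.exp_pos _), ← mul_div_assoc, le_div_iff₀ (by positivity), mul_comm]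
    exact pow_mul_exp_neg_le hc hs0.le j
  induction N generalizing j with
  | zero => exact .of_bound (hw j) hsm (by positivity) (hbd j)
  | succ N ih =>
    refine .of_deriv (g := fun _ s => -c * Real.exp (-(c * s))) ha (hw j) hsm (hbd j)
      (fun t ht s hs => ?_) (((ih (j + 1)).const_mul _).mono_weight ha
        (fun s hs => div_nonneg (hw j s hs) hs.le) zero_le_one fun s hs => ?_)
    · have := (((hasDerivAt_id s).const_mul c).neg).exp
      simpa [mul_comm] using this
    · rw [one_mul, pow_succ, div_div]

/-- Each derivative brings down `φ'`, of weight `1` instead of `s⁻¹`, which costs one factor `1 +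
s`. -/
theorem isSymbol_cos_sin (ha : 0 < a) {φ : ℝ → ℝ → ℝ} (N : ℕ)
    (hφ : ∀ N, IsSymbol a N (fun s => s) φ) :
    IsSymbol a N (fun s => (1 + s) ^ N) (fun t s => Real.cos (φ t s)) ∧
    IsSymbol a N (fun s => (1 + s) ^ N) (fun t s => Real.sin (φ t s)) := by
  have hw (N : ℕ) : ∀ s : ℝ, 0 < s → 0 ≤ (1 + s) ^ N := fun s hs => by positivity
  have hc : ∀ t, 0 < t → ContDiffOn ℝ ∞ (fun s => Real.cos (φ t s)) (Ioi (a * t)) :=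
    fun t ht => ((hφ 0).2.1 t ht).cos
  have hs : ∀ t, 0 < t → ContDiffOn ℝ ∞ (fun s => Real.sin (φ t s)) (Ioi (a * t)) :=
    fun t ht => ((hφ 0).2.1 t ht).sin
  have h1 (N : ℕ) : ∀ t : ℝ, 0 < t → ∀ s, a * t < s → 1 ≤ 1 * (1 + s) ^ N := fun t ht s hs => by
    have hs0 : 0 < s := (by positivity : 0 < a * t).trans hs
    rw [one_mul]
    exact one_le_pow₀ (by linarith)
  induction N with
  | zero =>
    exact ⟨.of_bound (hw 0) hc zero_le_one fun t ht s hs =>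
      (Real.abs_cos_le_one _).trans (h1 0 t ht s hs),
      .of_bound (hw 0) hs zero_le_one fun t ht s hs =>
      (Real.abs_sin_le_one _).trans (h1 0 t ht s hs)⟩
  | succ N ih =>
    have hle : ∀ s : ℝ, 0 < s → (1 + s) ^ N * (s / s) ≤ 1 * ((1 + s) ^ (N + 1) / s) :=
      fun s hs => by
        rw [one_mul, ← mul_div_assoc, pow_succ]
        gcongr
        linarith
    have hd : ∀ t, 0 < t → ∀ s, a * t < s → HasDerivAt (φ t) (deriv (φ t) s) s :=
      fun t ht s hs => (((hφ 0).contDiffAt ht hs).differentiableAt (by simp)).hasDerivAt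
    have hw' : ∀ s : ℝ, 0 < s → 0 ≤ (1 + s) ^ (N + 1) / s := fun s hs => by positivity
    refine ⟨.of_deriv (g := fun t s => -1 * (Real.sin (φ t s) * deriv (φ t) s)) ha (hw _) hc
      (fun t ht s hs => (Real.abs_cos_le_one _).trans (h1 _ t ht s hs)) (fun t ht s hs => ?_)
      (((ih.2.mul ha (hφ (N + 1)).deriv_right).const_mul _).mono_weight ha hw' zero_le_one hle),
      .of_deriv (g := fun t s => Real.cos (φ t s) * deriv (φ t) s) ha (hw _) hs
      (fun t ht s hs => (Real.abs_sin_le_one _).trans (h1 _ t ht s hs))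
      (fun t ht s hs => (hd t ht s hs).sin)
      ((ih.1.mul ha (hφ (N + 1)).deriv_right).mono_weight ha hw' zero_le_one hle)⟩
    simpa using (hd t ht s hs).cos

/-- The sine of a symbol of weight `s` vanishes like `s` at the origin. -/
theorem isSymbol_sin (ha : 0 < a) {φ : ℝ → ℝ → ℝ} (N : ℕ)
    (hφ : ∀ N, IsSymbol a N (fun s => s) φ) :
    IsSymbol a N (fun s => s * (1 + s) ^ N) (fun t s => Real.sin (φ t s)) := by
  have hw (N : ℕ) : ∀ s : ℝ, 0 < s → 0 ≤ s * (1 + s) ^ N := fun s hs => by positivity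
  obtain ⟨C, hC0, hC⟩ := (hφ 0).bound_zero
  have hs : ∀ t, 0 < t → ContDiffOn ℝ ∞ (fun s => Real.sin (φ t s)) (Ioi (a * t)) :=
    fun t ht => ((hφ 0).2.1 t ht).sin
  have hb (N : ℕ) : ∀ t, 0 < t → ∀ s, a * t < s → |Real.sin (φ t s)| ≤ C * (s * (1 + s) ^ N) :=
    fun t ht s hs => by
      have hs0 : 0 < s := (by positivity : 0 < a * t).trans hs
      have h1 : 1 ≤ (1 + s) ^ N := one_le_pow₀ (by linarith)
      calc _ ≤ |φ t s| := Real.abs_sin_le_abs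
        _ ≤ C * s := hC t ht s hs
        _ ≤ C * (s * (1 + s) ^ N) := by
          gcongr
          exact le_mul_of_one_le_right hs0.le h1
  cases N with
  | zero => exact .of_bound (hw 0) hs hC0 (hb 0)
  | succ N =>
    have hd : ∀ t, 0 < t → ∀ s, a * t < s → HasDerivAt (φ t) (deriv (φ t) s) s :=
      fun t ht s hs => (((hφ 0).contDiffAt ht hs).differentiableAt (by simp)).hasDerivAt
    -- Vanishing at the origin matters only at order zero: the weight `(1 + s)^N` of `cos φ · φ'`
    -- already fits.
    refine .of_deriv (g := fun t s => Real.cos (φ t s) * deriv (φ t) s) ha (hw _) hs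
      (hb _) (fun t ht s hs => (hd t ht s hs).sin)
      (((isSymbol_cos_sin ha N hφ).1.mul ha (hφ (N + 1)).deriv_right).mono_weight ha
        (fun s hs => div_nonneg (hw _ s hs) hs.le) zero_le_one fun s hs => ?_)
    rw [one_mul, mul_div_cancel_left₀ _ hs.ne', div_self hs.ne', mul_one, pow_succ]
    exact le_mul_of_one_le_right (by positivity) (by linarith)

/-- Rescalings of a smooth function that is constant near infinity. -/
theorem isSymbol_cutoff (ha : 0 < a) {X : ℝ → ℝ} (hX : ContDiff ℝ ∞ X) {R c : ℝ}
    (hR : ∀ u, R ≤ u → X u = c) (N : ℕ) :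
    IsSymbol a N (fun _ => 1) (fun t s => X (t⁻¹ * s)) := by
  -- `u^k X⁽ᵏ⁾(u)` is invariant under rescaling, hence the uniformity in `t`.
  have key (k : ℕ) : ∃ C, 0 ≤ C ∧ ∀ u, 0 < u → |u ^ k * iteratedDeriv k X u| ≤ C := by
    have hcont : Continuous (fun u => u ^ k * iteratedDeriv k X u) :=
      (continuous_pow k).mul (hX.continuous_iteratedDeriv k (by exact_mod_cast le_top))
    obtain ⟨C, hC⟩ := (isCompact_Icc (a := (0 : ℝ)) (b := R)).exists_bound_of_continuousOn
      hcont.continuousOn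
    refine ⟨max C |c|, le_max_of_le_right (abs_nonneg c), fun u hu => ?_⟩
    rcases le_or_gt u R with h | h
    · exact (hC u ⟨hu.le, h⟩).trans (le_max_left _ _)
    · have e : X =ᶠ[𝓝 u] fun _ => c := by
        filter_upwards [Ioi_mem_nhds h] with v hv using hR v (le_of_lt hv)
      rw [e.iteratedDeriv_eq, iteratedDeriv_const]
      refine le_trans ?_ (le_max_right _ _)
      split_ifs with hk
      · simp [hk]
      · simp
  choose C hC0 hC using key
  refine ⟨fun _ _ => zero_le_one, fun t ht => (hX.comp (by fun_prop)).contDiffOn,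
    ∑ i ∈ Finset.range (N + 1), C i, Finset.sum_nonneg fun i _ => hC0 i,
    fun t ht s hs k hk => ?_⟩
  have hs0 : 0 < s := (by positivity : 0 < a * t).trans hs
  rw [iteratedDeriv_comp_const_mul (hX.of_le (by exact_mod_cast le_top)), mul_one_div,
    le_div_iff₀ (by positivity)]
  calc _ = |(t⁻¹ * s) ^ k * iteratedDeriv k X (t⁻¹ * s)| := by
        rw [mul_pow, abs_mul, abs_mul, abs_mul, abs_of_pos (pow_pos hs0 k)]; ring
    _ ≤ C k := hC k _ (by positivity)
    _ ≤ _ := Finset.single_le_sum (f := C) (fun i _ => hC0 i) (Finset.mem_range.mpr (by omega))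

/-! ### The rescaled symbol. -/

/-- The rescaled symbol `t^{α/2} m(t, η/√t)` as a function of `s = |η|²`; here `b = 1 - ε²` and
`X u = χ (√u)`. -/
noncomputable def profile (b α c₁ c₂ : ℝ) (X : ℝ → ℝ) (t s : ℝ) : ℝ :=
  Real.exp (-(c₁ * s)) * s ^ (α / 2) *
    (Real.sin (c₂ * ((b * s + 1 * t) ^ (1 / 2 : ℝ) * s ^ (1 / 2 : ℝ))) *
      ((b * s + 1 * t) ^ (-(1 / 2) : ℝ) * s ^ (1 / 2 : ℝ))) * X (t⁻¹ * s)

theorem profile_weight_le {α c : ℝ} (hα : 0 ≤ α) (hc : 0 < c) (N : ℕ) :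
    ∃ K, 0 ≤ K ∧ ∀ s, 0 < s → Real.exp (-(c * s)) * s ^ α * (1 + s) ^ N ≤
      K * Real.exp (-(c / 2 * s)) := by
  set M := ⌈α⌉₊
  -- The factor `e^c` comes from applying `pow_mul_exp_neg_le` at `1 + s`.
  refine ⟨Real.exp c * ((M + N).factorial * ((c / 2) ^ (M + N))⁻¹), by positivity,
    fun s hs => ?_⟩
  have h1 : s ^ α ≤ (1 + s) ^ M := by
    calc s ^ α ≤ (1 + s) ^ α := by gcongr; linarith
      _ ≤ (1 + s) ^ (M : ℝ) := Real.rpow_le_rpow_of_exponent_le (by linarith) (Nat.le_ceil α)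
      _ = _ := Real.rpow_natCast _ _
  calc _ ≤ Real.exp (-(c * s)) * (1 + s) ^ M * (1 + s) ^ N := by gcongr
    _ = Real.exp c * ((1 + s) ^ (M + N) * Real.exp (-(c * (1 + s)))) := by
      rw [show -(c * s) = c + -(c * (1 + s)) by ring, Real.exp_add, pow_add]; ring
    _ ≤ Real.exp c * ((M + N).factorial * ((c / 2) ^ (M + N))⁻¹ *
        Real.exp (-(c / 2 * (1 + s)))) := by
      exact mul_le_mul_of_nonneg_left (pow_mul_exp_neg_le hc (by linarith) _) (Real.exp_pos c).le
    _ ≤ Real.exp c * ((M + N).factorial * ((c / 2) ^ (M + N))⁻¹ * Real.exp (-(c / 2 * s))) := by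
      have : c / 2 * s ≤ c / 2 * (1 + s) := by nlinarith
      gcongr
    _ = _ := by ring

/-- The rate drops from `c₁` to `c₁/2` in `isSymbol_exp`, then to `c₁/4` in absorbing `s^(α/2) (1 +
s)^N`. -/
theorem isSymbol_profile {a b α c₁ c₂ : ℝ} {X : ℝ → ℝ} (ha : 0 < a) (hb : 0 < b) (hα : 0 ≤ α)
    (hc₁ : 0 < c₁) (hX : ContDiff ℝ ∞ X) {R c : ℝ} (hR : ∀ u, R ≤ u → X u = c) (N : ℕ) :
    IsSymbol a N (fun s => s * Real.exp (-(c₁ / 4 * s))) (profile b α c₁ c₂ X) := by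
  have hφ (N : ℕ) : IsSymbol a N (fun s => s)
      (fun t s => c₂ * ((b * s + 1 * t) ^ (1 / 2 : ℝ) * s ^ (1 / 2 : ℝ))) :=
    (((isSymbol_rpow ha hb zero_le_one N (1 / 2)).mul ha
      (isSymbol_rpow_self ha N (1 / 2))).const_mul c₂).mono_weight ha (fun s hs => hs.le)
      zero_le_one fun s hs => by rw [← Real.rpow_add hs]; norm_num
  obtain ⟨K, hK0, hK⟩ := profile_weight_le (α := α / 2) (c := c₁ / 2) (by positivity)
    (by positivity) N
  refine ((((isSymbol_exp ha hc₁ N 0).mul ha (isSymbol_rpow_self ha N (α / 2))).mul ha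
    ((isSymbol_sin ha N hφ).mul ha ((isSymbol_rpow ha hb zero_le_one N (-(1 / 2))).mul ha
      (isSymbol_rpow_self ha N (1 / 2))))).mul ha (isSymbol_cutoff ha hX hR N)).mono_weight ha
    (fun s hs => by positivity) hK0 fun s hs => ?_
  have e : s ^ (-(1 / 2) : ℝ) * s ^ (1 / 2 : ℝ) = 1 := by rw [← Real.rpow_add hs]; norm_num
  rw [e, pow_zero, div_one, mul_one, mul_one]
  calc _ = s * (Real.exp (-(c₁ / 2 * s)) * s ^ (α / 2) * (1 + s) ^ N) := by ring
    _ ≤ s * (K * Real.exp (-(c₁ / 2 / 2 * s))) := mul_le_mul_of_nonneg_left (hK s hs) hs.le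
    _ = _ := by ring_nf

/-- The open sets `s < 2 a t` and `s > a t` cover the line, so this extends smoothness and bounds
past the region of the symbol estimates. -/
theorem profile_eq_zero {a b α c₁ c₂ : ℝ} {X : ℝ → ℝ} (hX0 : ∀ u, u ≤ 2 * a → X u = 0)
    {t s : ℝ} (ht : 0 < t) (hs : s ≤ 2 * a * t) : profile b α c₁ c₂ X t s = 0 := by
  rw [profile, hX0, mul_zero]
  rw [inv_mul_le_iff₀ ht]
  linarith

theorem contDiff_profile {a b α c₁ c₂ : ℝ} {X : ℝ → ℝ} (ha : 0 < a) (hb : 0 < b) (hα : 0 ≤ α)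
    (hc₁ : 0 < c₁) (hX : ContDiff ℝ ∞ X) {R c : ℝ} (hR : ∀ u, R ≤ u → X u = c)
    (hX0 : ∀ u, u ≤ 2 * a → X u = 0) {t : ℝ} (ht : 0 < t) :
    ContDiff ℝ ∞ (profile b α c₁ c₂ X t) := by
  rw [contDiff_iff_contDiffAt]
  intro s
  rcases lt_or_ge (a * t) s with h | h
  · exact (isSymbol_profile ha hb hα hc₁ hX hR 0).contDiffAt ht h
  · have e : profile b α c₁ c₂ X t =ᶠ[𝓝 s] fun _ => 0 := by
      have : s < 2 * a * t := by nlinarith [mul_pos ha ht]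
      filter_upwards [Iio_mem_nhds this] with u hu using profile_eq_zero hX0 ht (le_of_lt hu)
    exact contDiffAt_const.congr_of_eventuallyEq e

theorem profile_bound {a b α c₁ c₂ : ℝ} {X : ℝ → ℝ} (ha : 0 < a) (hb : 0 < b) (hα : 0 ≤ α)
    (hc₁ : 0 < c₁) (hX : ContDiff ℝ ∞ X) {R c : ℝ} (hR : ∀ u, R ≤ u → X u = c)
    (hX0 : ∀ u, u ≤ 2 * a → X u = 0) (N : ℕ) :
    ∃ C, 0 ≤ C ∧ ∀ t, 0 < t → ∀ s, 0 < s → ∀ k ≤ N,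
      |iteratedDeriv k (profile b α c₁ c₂ X t) s| ≤ C * (s * Real.exp (-(c₁ / 4 * s)) / s ^ k) := by
  obtain ⟨-, -, C, hC0, hC⟩ := isSymbol_profile (c₂ := c₂) ha hb hα hc₁ hX hR N
  refine ⟨C, hC0, fun t ht s hs0 k hk => ?_⟩
  rcases lt_or_ge (a * t) s with h | h
  · exact hC t ht s h k hk
  · have e : profile b α c₁ c₂ X t =ᶠ[𝓝 s] fun _ => 0 := by
      have : s < 2 * a * t := by nlinarith [mul_pos ha ht]
      filter_upwards [Iio_mem_nhds this] with u hu using profile_eq_zero hX0 ht (le_of_lt hu)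
    rw [e.iteratedDeriv_eq, iteratedDeriv_const]
    simp only [ite_self, abs_zero]
    positivity

/-! ### Derivatives of functions of `|x|²`. -/

section Radial

variable {E : Type*} [NormedAddCommGroup E] [InnerProductSpace ℝ E]

theorem norm_iteratedFDeriv_id_le {x : E} (hx : x ≠ 0) (i : ℕ) :
    ‖iteratedFDeriv ℝ i (fun y : E => y) x‖ ≤ ‖x‖ * (‖x‖⁻¹) ^ i := by
  have hx0 : 0 < ‖x‖ := norm_pos_iff.mpr hx
  rcases i with _ | _ | i
  · simp
  · rw [zero_add, ← norm_iteratedFDeriv_fderiv, norm_iteratedFDeriv_zero, pow_one,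
      mul_inv_cancel₀ hx0.ne', fderiv_fun_id]
    exact ContinuousLinearMap.norm_id_le
  · rw [← norm_iteratedFDeriv_fderiv]
    have : fderiv ℝ (fun y : E => y) = fun _ => ContinuousLinearMap.id ℝ E := by
      ext1; exact fderiv_fun_id
    rw [this, iteratedFDeriv_succ_const]
    simp only [Pi.zero_apply, norm_zero]
    positivity

theorem norm_iteratedFDeriv_norm_sq_le {x : E} (hx : x ≠ 0) (k : ℕ) :
    ‖iteratedFDeriv ℝ k (fun y : E => ‖y‖ ^ 2) x‖ ≤ ‖x‖ ^ 2 * (2 * ‖x‖⁻¹) ^ k := by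
  have hx0 : 0 < ‖x‖ := norm_pos_iff.mpr hx
  obtain ⟨B, hB1, hB⟩ : ∃ B : E →L[ℝ] E →L[ℝ] ℝ, ‖B‖ ≤ 1 ∧ ∀ y, ‖y‖ ^ 2 = B y y :=
    ⟨(isBoundedBilinearMap_inner (𝕜 := ℝ)).toContinuousLinearMap,
      ContinuousLinearMap.opNorm_le_bound₂ _ zero_le_one fun y z => by
        rw [one_mul]; exact norm_inner_le_norm y z,
      fun y => (real_inner_self_eq_norm_sq y).symm⟩
  rw [funext hB]
  refine (B.norm_iteratedFDeriv_le_of_bilinear_of_le_one (N := k) (f := fun y : E => y)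
    (g := fun y : E => y) contDiff_id contDiff_id x le_rfl hB1).trans ?_
  calc _ ≤ ∑ i ∈ Finset.range (k + 1), (k.choose i : ℝ) * (‖x‖ ^ 2 * (‖x‖⁻¹) ^ k) := by
        refine Finset.sum_le_sum fun i hi => ?_
        have hik : i ≤ k := Nat.lt_succ_iff.mp (Finset.mem_range.mp hi)
        rw [mul_assoc]
        refine mul_le_mul_of_nonneg_left ?_ (Nat.cast_nonneg _)
        calc _ ≤ (‖x‖ * (‖x‖⁻¹) ^ i) * (‖x‖ * (‖x‖⁻¹) ^ (k - i)) :=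
              mul_le_mul (norm_iteratedFDeriv_id_le hx _) (norm_iteratedFDeriv_id_le hx _)
                (norm_nonneg _) (by positivity)
          _ = ‖x‖ ^ 2 * ((‖x‖⁻¹) ^ i * (‖x‖⁻¹) ^ (k - i)) := by ring
          _ = _ := by rw [← pow_add, Nat.add_sub_cancel' hik]
    _ = _ := by
        rw [← Finset.sum_mul, mul_pow, ← Nat.cast_sum, Nat.sum_range_choose]
        push_cast
        ring

/-- Scale-invariant derivative bounds for a function of `|x|²`. -/
theorem norm_iteratedFDeriv_comp_norm_sq_le {F : ℝ → ℝ} (hF : ContDiff ℝ ∞ F) {x : E}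
    (hx : x ≠ 0) (k : ℕ) {W : ℝ}
    (hW : ∀ i ≤ k, |iteratedDeriv i F (‖x‖ ^ 2)| ≤ W / (‖x‖ ^ 2) ^ i) :
    ‖iteratedFDeriv ℝ k (fun y : E => F (‖y‖ ^ 2)) x‖ ≤ k.factorial * W * (2 * ‖x‖⁻¹) ^ k := by
  have hx0 : 0 < ‖x‖ := norm_pos_iff.mpr hx
  set r := ‖x‖ ^ 2 with hr
  have hr0 : 0 < r := by positivity
  -- Dividing by `r = |x|²` gives the inner map derivative bounds `D^i`, `D = 2/|x|`, with no
  -- prefactor, as `norm_iteratedFDeriv_comp_le` requires.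
  have e : (fun y : E => F (‖y‖ ^ 2)) = (fun u => F (r * u)) ∘ (fun y : E => r⁻¹ • ‖y‖ ^ 2) := by
    ext y
    simp [hr0.ne']
  have hg : ContDiff ℝ ∞ (fun u => F (r * u)) := hF.comp (contDiff_const.mul contDiff_id)
  have hq (m : ℕ∞ω) : ContDiff ℝ m (fun y : E => ‖y‖ ^ 2) := contDiff_norm_sq ℝ
  have hf : ContDiff ℝ ∞ (fun y : E => r⁻¹ • ‖y‖ ^ 2) := (hq ∞).const_smul r⁻¹
  have hk : (k : ℕ∞ω) ≤ ∞ := by exact_mod_cast le_top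
  rw [e]
  refine norm_iteratedFDeriv_comp_le hg hf hk x (fun i hi => ?_) (fun i _ _ => ?_)
  · rw [norm_iteratedFDeriv_eq_norm_iteratedDeriv,
      iteratedDeriv_comp_const_mul (hF.of_le (by exact_mod_cast le_top))]
    beta_reduce
    rw [smul_eq_mul, ← hr, inv_mul_cancel₀ hr0.ne', mul_one, norm_mul, Real.norm_eq_abs, Real.norm_eq_abs,
      abs_of_pos (by positivity), mul_comm, ← le_div_iff₀ (by positivity)]
    exact hW i hi
  · rw [iteratedFDeriv_const_smul_apply' (hq i).contDiffAt, norm_smul, norm_inv,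
      Real.norm_of_nonneg hr0.le, inv_mul_le_iff₀ hr0]
    exact norm_iteratedFDeriv_norm_sq_le hx i

end Radial

/-! ### `L¹` bounds for Fourier transforms. -/

section FourierL1

open FourierTransform

variable {n : ℕ}

theorem invFourier_eq_fourier (f : EuclideanSpace ℝ (Fin n) → ℂ) (x : EuclideanSpace ℝ (Fin n)) :
    invFourier f x = (((2 * Real.pi) ^ n : ℝ) : ℂ)⁻¹ * 𝓕 f ((-(2 * Real.pi)⁻¹) • x) := by
  have h := Real.fourierInv_eq_fourier_neg f ((2 * Real.pi)⁻¹ • x)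
  rw [← neg_smul] at h
  rw [invFourier, ← h, Real.fourierInv_eq']
  congr 1
  refine integral_congr_ae (.of_forall fun ξ => ?_)
  have : 2 * Real.pi * inner ℝ ξ ((2 * Real.pi)⁻¹ • x) = inner ℝ x ξ := by
    rw [real_inner_smul_right, real_inner_comm]
    field_simp
  simp only [this, smul_eq_mul, mul_comm Complex.I]

/-- The decay estimates of orders `0` and `n + 1` are added, using `(1 + |w|)^(n+1) ≤ 2^n (1 +
|w|^(n+1))`. -/
theorem norm_fourier_le {f : EuclideanSpace ℝ (Fin n) → ℂ} (hf : ContDiff ℝ ∞ f)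
    (hint : ∀ j ≤ n + 1, Integrable (iteratedFDeriv ℝ j f)) (w : EuclideanSpace ℝ (Fin n)) :
    ‖𝓕 f w‖ ≤ 2 ^ n * (1 + 2 ^ (n + 1)) *
      (∑ j ∈ Finset.range (n + 2), ∫ x, ‖iteratedFDeriv ℝ j f x‖) *
        (1 + ‖w‖) ^ (-((n + 1 : ℕ) : ℝ)) := by
  set A := ∑ j ∈ Finset.range (n + 2), ∫ x, ‖iteratedFDeriv ℝ j f x‖ with hA
  have hdec (m : ℕ) (hm : m ≤ n + 1) : ‖w‖ ^ m * ‖𝓕 f w‖ ≤ 2 ^ m * A := by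
    have h := Real.pow_mul_norm_iteratedFDeriv_fourier_le (K := 0) (N := (n + 1 : ℕ)) (k := 0)
      (n := m) (f := f) (hf.of_le (by exact_mod_cast le_top)) (fun k j hk hj => by
        obtain rfl : k = 0 := by simpa using hk
        simpa using (hint j (by exact_mod_cast hj)).norm) le_rfl (by exact_mod_cast hm) w
    rw [Finset.sum_product] at h
    simp only [norm_iteratedFDeriv_zero, pow_zero, one_mul, CharP.cast_eq_zero, mul_zero,
      zero_add, Finset.range_one, Finset.sum_singleton] at h
    refine h.trans ?_
    gcongr
    refine Finset.sum_le_sum_of_subset_of_nonneg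
      (Finset.range_subset_range.mpr (by omega)) fun i _ _ => by positivity
  have h0 := hdec 0 (Nat.zero_le _)
  have h1 := hdec (n + 1) le_rfl
  simp only [pow_zero, one_mul] at h0
  have h2 := add_pow_le zero_le_one (norm_nonneg w) (n + 1)
  rw [Nat.add_sub_cancel, one_pow] at h2
  rw [Real.rpow_neg (by positivity), Real.rpow_natCast, ← div_eq_mul_inv,
    le_div_iff₀ (by positivity)]
  calc _ ≤ ‖𝓕 f w‖ * (2 ^ n * (1 + ‖w‖ ^ (n + 1))) := by gcongr
    _ = 2 ^ n * (‖𝓕 f w‖ + ‖w‖ ^ (n + 1) * ‖𝓕 f w‖) := by ring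
    _ ≤ 2 ^ n * (A + 2 ^ (n + 1) * A) := by gcongr
    _ = _ := by ring

/-- `n + 1` integrable derivatives control the `L¹` norm of the inverse Fourier transform. -/
theorem exists_integral_norm_invFourier_le (n : ℕ) :
    ∃ K, 0 ≤ K ∧ ∀ f : EuclideanSpace ℝ (Fin n) → ℂ, ContDiff ℝ ∞ f →
      (∀ j ≤ n + 1, Integrable (iteratedFDeriv ℝ j f)) →
      Integrable (invFourier f) ∧ ∫ x, ‖invFourier f x‖ ≤
        K * ∑ j ∈ Finset.range (n + 2), ∫ x, ‖iteratedFDeriv ℝ j f x‖ := by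
  have hJ : Integrable (fun w : EuclideanSpace ℝ (Fin n) => (1 + ‖w‖) ^ (-((n + 1 : ℕ) : ℝ))) :=
    integrable_one_add_norm (by simp)
  refine ⟨2 ^ n * (1 + 2 ^ (n + 1)) *
    ∫ w : EuclideanSpace ℝ (Fin n), (1 + ‖w‖) ^ (-((n + 1 : ℕ) : ℝ)),
    mul_nonneg (by positivity) (integral_nonneg fun w => by positivity), fun f hf hint => ?_⟩
  have hf0 : Integrable f := by
    have := (hint 0 (Nat.zero_le _)).norm
    simp only [norm_iteratedFDeriv_zero] at this
    exact (integrable_norm_iff hf.continuous.aestronglyMeasurable).mp this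
  have hcont : Continuous (𝓕 f) :=
    VectorFourier.fourierIntegral_continuous Real.continuous_fourierChar
      (by exact continuous_inner) hf0
  have hbd := norm_fourier_le hf hint
  have hFi : Integrable (𝓕 f) :=
    (hJ.const_mul _).mono' hcont.aestronglyMeasurable (.of_forall hbd)
  have hpi : (-(2 * Real.pi)⁻¹ : ℝ) ≠ 0 := by simp [Real.pi_ne_zero]
  rw [show invFourier f = _ from funext (invFourier_eq_fourier f)]
  refine ⟨(hFi.comp_smul hpi).const_mul _, ?_⟩
  simp only [norm_mul]
  -- The Jacobian `(2π)^n` cancels the normalising constant.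
  rw [integral_const_mul, Measure.integral_comp_smul volume (fun y => ‖𝓕 f y‖),
    finrank_euclideanSpace_fin, smul_eq_mul, ← mul_assoc, norm_inv, Complex.norm_real,
    Real.norm_eq_abs, abs_inv, abs_pow, abs_pow, abs_neg, abs_inv, inv_pow, inv_inv,
    inv_mul_cancel₀ (by positivity), one_mul]
  calc _ ≤ ∫ w, _ := integral_mono hFi.norm (hJ.const_mul _) hbd
    _ = _ := by rw [integral_const_mul]; ring

end FourierL1

/-! ### Integrability of the radial bounds. -/

section RadialIntegrable

variable {n : ℕ}

/-- In polar coordinates the power is `r^(n-1) r^(2-k) = r^(n+1-k)`, with nonnegative exponent. -/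
theorem integrable_norm_sq_mul_exp (hn : 1 ≤ n) {c : ℝ} (hc : 0 < c) {k : ℕ} (hk : k ≤ n + 1) :
    Integrable (fun x : EuclideanSpace ℝ (Fin n) =>
      ‖x‖ ^ 2 * Real.exp (-(c * ‖x‖ ^ 2)) * (‖x‖⁻¹) ^ k) := by
  have : Nonempty (Fin n) := ⟨⟨0, hn⟩⟩
  rw [integrable_fun_norm_addHaar volume
    (f := fun r : ℝ => r ^ 2 * Real.exp (-(c * r ^ 2)) * (r⁻¹) ^ k), finrank_euclideanSpace_fin]
  have hk' : (k : ℝ) ≤ n + 1 := by exact_mod_cast hk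
  refine (integrableOn_rpow_mul_exp_neg_mul_sq hc (s := (n : ℝ) + 1 - k)
    (by linarith)).congr_fun (fun r hr => ?_) measurableSet_Ioi
  have hr0 : (0 : ℝ) < r := hr
  have e : ((n : ℝ) + 1) = ((n - 1 + 2 : ℕ) : ℝ) := by
    rw [← Nat.cast_add_one]; congr 1; omega
  beta_reduce
  rw [Real.rpow_sub hr0, e, Real.rpow_natCast, Real.rpow_natCast, smul_eq_mul, pow_add, inv_pow,
    neg_mul]
  ring

/-- Uniform `L¹` bounds for the derivatives of radial functions `F_t(|x|²)`. -/
theorem exists_sum_integral_norm_iteratedFDeriv_le (hn : 1 ≤ n) {F : ℝ → ℝ → ℝ} {c C : ℝ}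
    (hc : 0 < c) (hC0 : 0 ≤ C) (hF : ∀ t, 0 < t → ContDiff ℝ ∞ (F t))
    (hC : ∀ t, 0 < t → ∀ s, 0 < s → ∀ k ≤ n + 1,
      |iteratedDeriv k (F t) s| ≤ C * (s * Real.exp (-(c * s)) / s ^ k)) :
    ∃ A, 0 ≤ A ∧ ∀ t, 0 < t →
      ContDiff ℝ ∞ (fun x : EuclideanSpace ℝ (Fin n) => (F t (‖x‖ ^ 2) : ℂ)) ∧
      (∀ j ≤ n + 1, Integrable (iteratedFDeriv ℝ j
        (fun x : EuclideanSpace ℝ (Fin n) => (F t (‖x‖ ^ 2) : ℂ)))) ∧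
      ∑ j ∈ Finset.range (n + 2), ∫ x, ‖iteratedFDeriv ℝ j
        (fun x : EuclideanSpace ℝ (Fin n) => (F t (‖x‖ ^ 2) : ℂ)) x‖ ≤ A := by
  have : Nonempty (Fin n) := ⟨⟨0, hn⟩⟩
  set B : ℕ → EuclideanSpace ℝ (Fin n) → ℝ := fun j x => j.factorial * C * 2 ^ j *
    (‖x‖ ^ 2 * Real.exp (-(c * ‖x‖ ^ 2)) * (‖x‖⁻¹) ^ j) with hB
  have hBi : ∀ j ≤ n + 1, Integrable (B j) := fun j hj =>
    (integrable_norm_sq_mul_exp hn hc hj).const_mul _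
  refine ⟨∑ j ∈ Finset.range (n + 2), ∫ x, B j x, Finset.sum_nonneg fun j _ =>
    integral_nonneg fun x => by simp only [hB]; positivity, fun t ht => ?_⟩
  have hq : ContDiff ℝ ∞ (fun x : EuclideanSpace ℝ (Fin n) => F t (‖x‖ ^ 2)) :=
    (hF t ht).comp (contDiff_norm_sq ℝ)
  have hqC : ContDiff ℝ ∞ (fun x : EuclideanSpace ℝ (Fin n) => (F t (‖x‖ ^ 2) : ℂ)) :=
    Complex.ofRealCLM.contDiff.comp hq
  have hbd : ∀ j ≤ n + 1, ∀ᵐ x : EuclideanSpace ℝ (Fin n), ‖iteratedFDeriv ℝ j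
      (fun x : EuclideanSpace ℝ (Fin n) => (F t (‖x‖ ^ 2) : ℂ)) x‖ ≤ B j x := fun j hj => by
    -- The bounds are singular at the origin, a null set since `n ≥ 1`.
    filter_upwards [Measure.ae_ne volume (0 : EuclideanSpace ℝ (Fin n))] with x hx
    have hx0 : 0 < ‖x‖ := norm_pos_iff.mpr hx
    have h1 := Complex.ofRealLI.norm_iteratedFDeriv_comp_left (x := x) (i := j) hq.contDiffAt
      (by exact_mod_cast le_top)
    refine h1.le.trans ((norm_iteratedFDeriv_comp_norm_sq_le (hF t ht) hx j
      (W := C * (‖x‖ ^ 2 * Real.exp (-(c * ‖x‖ ^ 2)))) fun i hi => ?_).trans (le_of_eq ?_))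
    · rw [mul_div_assoc]
      exact hC t ht _ (by positivity) i (hi.trans hj)
    · simp only [hB, mul_pow]
      ring
  have hint : ∀ j ≤ n + 1, Integrable (iteratedFDeriv ℝ j
      (fun x : EuclideanSpace ℝ (Fin n) => (F t (‖x‖ ^ 2) : ℂ))) := fun j hj =>
    (hBi j hj).mono' (hqC.continuous_iteratedFDeriv
      (by exact_mod_cast le_top)).aestronglyMeasurable (hbd j hj)
  refine ⟨hqC, hint, Finset.sum_le_sum fun j hj => ?_⟩
  have hj' : j ≤ n + 1 := Nat.lt_succ_iff.mp (Finset.mem_range.mp hj)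
  exact integral_mono_ae (hint j hj').norm (hBi j hj') (hbd j hj')

end RadialIntegrable

/-! ### Reduction to the rescaled symbol. -/

theorem IsHighFreqCutoff.comp_sqrt {ε : ℝ} {χ : ℝ → ℝ} (hχ : IsHighFreqCutoff ε χ)
    {R : ℝ} (hR : R = ((1 - ε ^ 2) ^ 2)⁻¹) (hR0 : 0 < R) :
    ContDiff ℝ ∞ (fun u => χ √u) ∧ (∀ u, (4 * R) ^ 2 ≤ u → χ √u = 1) ∧
      ∀ u, u ≤ 2 * (2 * R ^ 2) → χ √u = 0 := by
  have h0 : ∀ u, u ≤ 2 * (2 * R ^ 2) → χ √u = 0 := fun u hu =>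
    hχ.eq_zero _ (Real.sqrt_nonneg u) <| by
      rw [← hR]
      exact Real.sqrt_le_iff.mpr ⟨by positivity, by linarith⟩
  refine ⟨?_, fun u hu => hχ.eq_one _ ?_, h0⟩
  · rw [contDiff_iff_contDiffAt]
    intro u
    rcases lt_or_ge 0 u with h | h
    · exact hχ.smooth.contDiffAt.comp u (Real.contDiffAt_sqrt h.ne')
    -- The square root is not smooth at `0`, but the composite vanishes for all `u < 4R²`, negative
    -- `u` included.
    · have e : (fun u => χ √u) =ᶠ[𝓝 u] fun _ => 0 := by
        have : u < 2 * (2 * R ^ 2) := h.trans_lt (by positivity)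
        filter_upwards [Iio_mem_nhds this] with v hv using h0 v (le_of_lt hv)
      exact contDiffAt_const.congr_of_eventuallyEq e
  · rw [← hR]
    exact Real.le_sqrt_of_sq_le hu

/-- With `s = t|ξ|²`, `g_H = ((b s + t)/s)^(1/2)`, so the phase is `c₂ s g_H = c₂ (b s + t)^(1/2)
s^(1/2)`. -/
theorem symbolHigh_eq_profile {n : ℕ} {ε α c₁ c₂ : ℝ} {χ : ℝ → ℝ} (hb : 0 < 1 - ε ^ 2)
    (hχ0 : χ 0 = 0) {t : ℝ} (ht : 0 < t) (ξ : EuclideanSpace ℝ (Fin n)) :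
    symbolHigh ε α c₁ c₂ χ t ξ = t ^ (-α / 2) *
      profile (1 - ε ^ 2) α c₁ c₂ (fun u => χ √u) t (‖√t • ξ‖ ^ 2) := by
  have hs : ‖√t • ξ‖ ^ 2 = t * ‖ξ‖ ^ 2 := by
    rw [norm_smul, mul_pow, Real.norm_eq_abs, sq_abs, Real.sq_sqrt ht.le]
  have hX : √(t⁻¹ * (t * ‖ξ‖ ^ 2)) = ‖ξ‖ := by
    rw [inv_mul_cancel_left₀ ht.ne', Real.sqrt_sq (norm_nonneg _)]
  rw [symbolHigh, profile, hs, hX]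
  rcases (norm_nonneg ξ).eq_or_lt with h0 | hr
  · simp [← h0, hχ0]
  set r := ‖ξ‖
  have hG : gHigh ε r = ((1 - ε ^ 2) + (r ^ 2)⁻¹) ^ (1 / 2 : ℝ) := Real.sqrt_eq_rpow _
  have hG0 : 0 < gHigh ε r := Real.sqrt_pos.mpr (by positivity)
  have hS : (1 - ε ^ 2) * (t * r ^ 2) + 1 * t = (t * r ^ 2) * ((1 - ε ^ 2) + (r ^ 2)⁻¹) := by
    field_simp
  have hP : ((1 - ε ^ 2) * (t * r ^ 2) + 1 * t) ^ (1 / 2 : ℝ) =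
      (t * r ^ 2) ^ (1 / 2 : ℝ) * gHigh ε r := by
    rw [hS, Real.mul_rpow (by positivity) (by positivity), hG]
  have hQ0 : 0 < (t * r ^ 2) ^ (1 / 2 : ℝ) := by positivity
  have hQ : (t * r ^ 2) ^ (1 / 2 : ℝ) * (t * r ^ 2) ^ (1 / 2 : ℝ) = t * r ^ 2 := by
    rw [← Real.rpow_add (by positivity)]; norm_num
  have hα : t ^ (-α / 2) * (t * r ^ 2) ^ (α / 2) = r ^ α := by
    rw [Real.mul_rpow ht.le (by positivity), ← mul_assoc, ← Real.rpow_add ht, neg_div,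
      neg_add_cancel, Real.rpow_zero, one_mul, ← Real.rpow_natCast, ← Real.rpow_mul hr.le]
    congr 1
    push_cast
    ring
  rw [Real.rpow_neg (by positivity), hP, ← hα]
  have hsin : c₂ * ((t * r ^ 2) ^ (1 / 2 : ℝ) * gHigh ε r * (t * r ^ 2) ^ (1 / 2 : ℝ)) =
      c₂ * r ^ 2 * gHigh ε r * t := by
    rw [mul_right_comm, hQ]; ring
  have hdiv : ((t * r ^ 2) ^ (1 / 2 : ℝ) * gHigh ε r)⁻¹ * (t * r ^ 2) ^ (1 / 2 : ℝ) =
      (gHigh ε r)⁻¹ := by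
    field_simp
  rw [hsin, hdiv, show -(c₁ * (t * r ^ 2)) = -c₁ * r ^ 2 * t by ring]
  ring

theorem invFourier_const_mul_comp_smul {n : ℕ} (f : EuclideanSpace ℝ (Fin n) → ℂ) (c : ℂ) {l : ℝ}
    (hl : 0 < l) (x : EuclideanSpace ℝ (Fin n)) :
    invFourier (fun ξ => c * f (l • ξ)) x = c * (((l ^ n)⁻¹ : ℝ) : ℂ) * invFourier f (l⁻¹ • x) := by
  have h := Measure.integral_comp_smul volume (fun η : EuclideanSpace ℝ (Fin n) =>
    Complex.exp (Complex.I * ((inner ℝ (l⁻¹ • x) η : ℝ) : ℂ)) * f η) l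
  have e (ξ : EuclideanSpace ℝ (Fin n)) : inner ℝ (l⁻¹ • x) (l • ξ) = inner ℝ x ξ := by
    rw [real_inner_smul_left, real_inner_smul_right, inv_mul_cancel_left₀ hl.ne']
  simp only [e, finrank_euclideanSpace_fin] at h
  rw [abs_of_pos (by positivity), Complex.real_smul] at h
  simp only [invFourier]
  have e' : ∫ ξ : EuclideanSpace ℝ (Fin n),
      Complex.exp (Complex.I * ((inner ℝ x ξ : ℝ) : ℂ)) * (c * f (l • ξ)) =
      c * ∫ ξ, Complex.exp (Complex.I * ((inner ℝ x ξ : ℝ) : ℂ)) * f (l • ξ) := by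
    rw [← integral_const_mul]
    exact congrArg (integral volume) (funext fun ξ => by ring)
  rw [e', h]
  ring

/-- The factor `l^(-n)` from the frequency side cancels the Jacobian `l^n` in `x`. -/
theorem integrable_and_integral_norm_invFourier_comp_smul {n : ℕ}
    {f : EuclideanSpace ℝ (Fin n) → ℂ} (hf : Integrable (invFourier f)) (c : ℝ) {l : ℝ}
    (hl : 0 < l) :
    Integrable (invFourier (fun ξ => (c : ℂ) * f (l • ξ))) ∧
      ∫ x, ‖invFourier (fun ξ => (c : ℂ) * f (l • ξ)) x‖ = |c| * ∫ x, ‖invFourier f x‖ := by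
  rw [show invFourier (fun ξ => (c : ℂ) * f (l • ξ)) = _ from
    funext (invFourier_const_mul_comp_smul f c hl)]
  refine ⟨(hf.comp_smul (inv_ne_zero hl.ne')).const_mul _, ?_⟩
  simp only [norm_mul]
  rw [integral_const_mul, Measure.integral_comp_inv_smul volume (fun y => ‖invFourier f y‖),
    finrank_euclideanSpace_fin, smul_eq_mul, Complex.norm_real, Complex.norm_real,
    Real.norm_eq_abs, Real.norm_eq_abs, abs_inv, mul_assoc,
    inv_mul_cancel_left₀ (by positivity)]

end ViscousBoussinesq

open ViscousBoussinesq in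
theorem mainTheorem6 (n : ℕ) (hn : 1 ≤ n) (ε : ℝ) (hε : ε ∈ Set.Ioo (0 : ℝ) 1)
    (χ : ℝ → ℝ) (hχ : ViscousBoussinesq.IsHighFreqCutoff ε χ)
    (α c₁ c₂ : ℝ) (hα : 0 ≤ α) (hc₁ : 0 < c₁) (hc₂ : c₂ ≠ 0) :
    ∃ C : ℝ, 0 < C ∧ ∀ t : ℝ, 0 < t →
      Integrable (fun ξ : EuclideanSpace ℝ (Fin n) =>
        ViscousBoussinesq.symbolHigh ε α c₁ c₂ χ t ξ) volume ∧
      Integrable (fun x : EuclideanSpace ℝ (Fin n) =>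
        ViscousBoussinesq.kernelHigh ε α c₁ c₂ χ t x) volume ∧
      ∫ x : EuclideanSpace ℝ (Fin n), ‖ViscousBoussinesq.kernelHigh ε α c₁ c₂ χ t x‖
        ≤ C * t ^ (-α / 2) := by
  have hb : 0 < 1 - ε ^ 2 := by nlinarith [hε.1, hε.2]
  obtain ⟨R, hR⟩ : ∃ R : ℝ, R = ((1 - ε ^ 2) ^ 2)⁻¹ := ⟨_, rfl⟩
  have hR0 : 0 < R := by rw [hR]; positivity
  obtain ⟨hX, hX1, hX0⟩ := hχ.comp_sqrt hR hR0
  have ha : 0 < 2 * R ^ 2 := by positivity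
  have hχ0 : χ 0 = 0 := hχ.eq_zero 0 le_rfl (by rw [← hR]; positivity)
  obtain ⟨B, hB0, hB⟩ := profile_bound (c₂ := c₂) ha hb hα hc₁ hX hX1 hX0 (n + 1)
  obtain ⟨A, hA0, hA⟩ := exists_sum_integral_norm_iteratedFDeriv_le hn
    (by positivity : 0 < c₁ / 4) hB0
    (fun t ht => contDiff_profile (c₂ := c₂) ha hb hα hc₁ hX hX1 hX0 ht) hB
  obtain ⟨K, hK0, hK⟩ := exists_integral_norm_invFourier_le n
  -- `K` and `A` are only known to be nonnegative; the `1` makes the constant positive.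
  refine ⟨K * A + 1, by positivity, fun t ht => ?_⟩
  obtain ⟨hsm, hint, hsum⟩ := hA t ht
  obtain ⟨hi, hle⟩ := hK _ hsm hint
  have ht0 : 0 < √t := Real.sqrt_pos.mpr ht
  obtain ⟨hk1, hk2⟩ :=
    integrable_and_integral_norm_invFourier_comp_smul hi (t ^ (-α / 2)) ht0
  have hker : (fun x : EuclideanSpace ℝ (Fin n) => kernelHigh ε α c₁ c₂ χ t x) =
      invFourier (fun ξ => ((t ^ (-α / 2) : ℝ) : ℂ) *
        (profile (1 - ε ^ 2) α c₁ c₂ (fun u => χ √u) t (‖√t • ξ‖ ^ 2) : ℂ)) := by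
    ext x
    simp only [kernelHigh, symbolHigh_eq_profile hb hχ0 ht, Complex.ofReal_mul]
  refine ⟨?_, ?_, ?_⟩
  · have h0 : Integrable (fun x : EuclideanSpace ℝ (Fin n) =>
        profile (1 - ε ^ 2) α c₁ c₂ (fun u => χ √u) t (‖x‖ ^ 2)) := by
      have h := (hint 0 (Nat.zero_le _)).norm
      simp only [norm_iteratedFDeriv_zero] at h
      exact ((integrable_norm_iff hsm.continuous.aestronglyMeasurable).mp h).re
    simp only [symbolHigh_eq_profile hb hχ0 ht]
    exact (h0.comp_smul ht0.ne').const_mul _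
  · rw [hker]
    exact hk1
  · have e : ∀ x : EuclideanSpace ℝ (Fin n), kernelHigh ε α c₁ c₂ χ t x = _ := congrFun hker
    simp only [e]
    rw [hk2, abs_of_pos (by positivity), mul_comm]
    gcongr
    calc _ ≤ K * A := hle.trans (by gcongr)
      _ ≤ _ := by linarith
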